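/- Theorem (Base-optimized maximum-load tail). Write \(\ln\) for the natural logarithm and \(\log\) for the logarithm to base \(2\). For integers \(u\ge \ell\), a set \(S\subseteq\mathbb F_2^u\) and a linear map \(h:\mathbb F_2^u\to\mathbb F_2^\ell\), let \[ \mathsf M(S,h):=\max_{y\in\mathbb F_2^\ell}\bigl|\{x\in S: h(x)=y\}\bigr| \] be the maximum load. There exist absolute constants \(C>0\), \(D>0\) and \(\ell_0\) such that the following holds. Let \(\ell\ge\ell_0\) and \(u\ge\ell\) be integers, let \(n:=2^\ell\), let \(S\subseteq\mathbb F_2^u\) have size \(n\), and let \(h:\mathbb F_2^u\to\mathbb F_2^\ell\) be a uniformly random linear map (not necessarily surjective). Then, for every real \(R>1\) satisfying \(R\,\ell^{1-1/R}\ge D\ln\ell\), \[ \Pr_h\left[\mathsf M(S,h)\ge R\,\frac{\ell}{\log\ell}\right] \le C\,\frac{(\ln\ell)^2}{R^2\,\ell^{2-2/R}}. \] Likewise, in terms of \(n\) and with base-\(2\) logarithms throughout, for every real \(R>1\) satisfying \(R(\log n)^{1-1/R}\ge D\log\log n\), \[ \Pr_h\left[\mathsf M(S,h)\ge R\,\frac{\log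 n}{\log\log n}\right] \le C\,\frac{(\log\log n)^2}{R^2(\log n)^{2-2/R}}. \] -/

import Mathlib

/-- The vector space `F_2^k`. -/
abbrev F2Vec (k : ℕ) : Type := Fin k → ZMod 2

/-- The (finite) set of linear maps from `F_2^u` to `F_2^l`. -/
abbrev LinHash (u l : ℕ) : Type := F2Vec u →ₗ[ZMod 2] F2Vec l

noncomputable instance instFintypeLinHash (u l : ℕ) : Fintype (LinHash u l) :=
  Fintype.ofInjective (fun h : LinHash u l => (h : F2Vec u → F2Vec l)) DFunLike.coe_injective

/-- The law of a uniformly random linear map from `F_2^u` to `F_2^l`. -/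
noncomputable def randomLinHash (u l : ℕ) : PMF (LinHash u l) :=
  PMF.uniformOfFintype (LinHash u l)

/-- The probability that a uniformly random linear map from `F_2^u` to `F_2^l` lies in `A`. -/
noncomputable def prLinHash (u l : ℕ) (A : Set (LinHash u l)) : ℝ :=
  ((randomLinHash u l).toOuterMeasure A).toReal

/-- The load of the bin `y`: the number of keys `x ∈ S` with `h x = y`. -/
def binLoad {u l : ℕ} (S : Finset (F2Vec u)) (h : LinHash u l) (y : F2Vec l) : ℕ :=
  (S.filter (fun x => h x = y)).card

/-- The maximum load `M(S, h)`, the maximum of the loads over all bins. -/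
def maxLoad {u l : ℕ} (S : Finset (F2Vec u)) (h : LinHash u l) : ℕ :=
  Finset.univ.sup' Finset.univ_nonempty (fun y : F2Vec l => binLoad S h y)

/-!
The argument follows an exponential potential while the kernel of the hash function is generated one
random vector at a time. Let `V` be the space of keys, of dimension `l + m`, and let `S` have
`2 ^ l` elements. Start with the weight `g = β` on `S` and `g = 1` elsewhere, and for uniform
directions `v₁, …, v_m` replace `g x` by `g x * g (x + v)` at each step. If `v₁, …, v_m` is a basis
of the kernel of a surjective `h`, the final weight of `x` is `β` to the load of the bin of `x`, so
that a bin of load `T` makes the mean weight at least `β ^ T / 2 ^ l`; this is `exp T` for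
`β = e * 2 ^ (l / T)`.

Write `Φ` for the mean weight minus `1`. A step turns `Φ` into `2 * Φ` plus a nonnegative excess of
mean `Φ ^ 2`. Markov's inequality in the form of an induction gives
`P(final mean ≥ exp (2 ^ m * s)) ≤ Φ / (exp s - 1)` (`tailProb_le_div`), which alone yields a tail
of order `β / T`. The tail `(β / T) ^ 2` comes from `tailProb_le_sq`: `Φ` is compared with a
deterministic barrier `a * (s + s ^ (3 / 2))`, where `a` is of order `β / T` and `s` doubles at each
step until it equals `T`. The final barrier is below `exp T - 1`; leaving the barrier at an
intermediate time already has small probability, and the first-moment bound is then applied from the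
point of exit. The resulting losses over all steps sum to `O(a ^ 2)`.

A uniform surjective `h` and the span of uniform vectors `v₁, …, v_m` are compared by counting pairs
(`card_surjective_le`). Maps that are not surjective are removed by enlarging the key space:
restricting a uniform map on `𝔽₂ ^ u × 𝔽₂ ^ w` gives a uniform map on `𝔽₂ ^ u`, and the larger map
fails to be surjective with probability tending to `0` as `w` grows. Altogether the load reaches `T`
with probability `O((2 ^ (l / T) / T) ^ 2)` (`prLinHash_maxLoad_le`), and `T = R * l / log l` gives
`2 ^ (l / T) = l ^ (1 / R)`.
-/

open scoped BigOperators

/-! ### Doubling steps -/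

section Doubling

variable {V : Type*} [AddCommGroup V] [Fintype V]

/-- One doubling step in direction `v`: the weight `g` of a point is multiplied by the weight of
its translate by `v`. For `g = β ^ f` this replaces the load `f x` by `f x + f (x + v)`. -/
def shiftMul (g : V → ℝ) (v : V) : V → ℝ := fun x => g x * g (x + v)

/-- The probability, over independent uniform directions `v₁, …, v_m`, that the mean of the
weight reaches `B` after `m` doubling steps starting from `g`. -/
noncomputable def tailProb (B : ℝ) : ℕ → (V → ℝ) → ℝ
  | 0, g => if B ≤ 𝔼 x, g x then 1 else 0
  | m + 1, g => 𝔼 v, tailProb B m (shiftMul g v)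

/-- The part of the mean of `shiftMul g v` that exceeds its minimal possible value
`2 * 𝔼 g - 1`. -/
noncomputable def excess (g : V → ℝ) (v : V) : ℝ := 𝔼 x, (g x - 1) * (g (x + v) - 1)

lemma one_le_shiftMul {V : Type*} [AddCommGroup V] {g : V → ℝ} (hg : ∀ x, 1 ≤ g x) (v x : V) :
    1 ≤ shiftMul g v x :=
  one_le_mul_of_one_le_of_one_le (hg x) (hg _)

lemma expect_comp_add_right (g : V → ℝ) (v : V) : 𝔼 x, g (x + v) = 𝔼 x, g x :=
  Fintype.expect_equiv (Equiv.addRight v) _ _ fun _ => rfl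

lemma expect_mul_translate (g : V → ℝ) : 𝔼 v, 𝔼 x, g x * g (x + v) = (𝔼 x, g x) ^ 2 := by
  rw [Finset.expect_comm, pow_two, Finset.expect_mul]
  refine Finset.expect_congr rfl fun x _ => ?_
  rw [← Finset.mul_expect]
  congr 1
  exact Fintype.expect_equiv (Equiv.addLeft x) _ _ fun _ => rfl

lemma expect_sub_one (g : V → ℝ) : 𝔼 x, (g x - 1) = 𝔼 x, g x - 1 := by
  have : Nonempty V := ⟨0⟩
  rw [Finset.expect_sub_distrib, Fintype.expect_const]

lemma excess_nonneg {g : V → ℝ} (hg : ∀ x, 1 ≤ g x) (v : V) : 0 ≤ excess g v :=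
  Finset.expect_nonneg fun x _ => mul_nonneg (by linarith [hg x]) (by linarith [hg (x + v)])

lemma expect_excess (g : V → ℝ) : 𝔼 v, excess g v = (𝔼 x, g x - 1) ^ 2 := by
  rw [← expect_sub_one, ← expect_mul_translate]; rfl

lemma expect_shiftMul_eq (g : V → ℝ) (v : V) :
    𝔼 x, shiftMul g v x - 1 = 2 * (𝔼 x, g x - 1) + excess g v := by
  have h : excess g v = 𝔼 x, (shiftMul g v x - g x - (g (x + v) - 1)) :=
    Finset.expect_congr rfl fun x _ => by simp only [shiftMul]; ring
  rw [h, Finset.expect_sub_distrib, Finset.expect_sub_distrib,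
    expect_sub_one (fun x => g (x + v)), expect_comp_add_right]
  ring

lemma expect_expect_shiftMul (g : V → ℝ) : 𝔼 v, 𝔼 x, shiftMul g v x = (𝔼 x, g x) ^ 2 :=
  expect_mul_translate g

lemma one_le_expect {g : V → ℝ} (hg : ∀ x, 1 ≤ g x) : 1 ≤ 𝔼 x, g x :=
  Finset.le_expect (Finset.univ_nonempty_iff.2 ⟨0⟩) fun x _ => hg x

lemma tailProb_le_one (B : ℝ) (m : ℕ) (g : V → ℝ) : tailProb B m g ≤ 1 := by
  induction m generalizing g with
  | zero => unfold tailProb; split_ifs <;> norm_num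
  | succ m ih =>
    exact Finset.expect_le (Finset.univ_nonempty_iff.2 ⟨0⟩) fun v _ => ih _

/-- A first-moment bound. One step sends `Φ = 𝔼 g - 1` to `2 * Φ + Φ ^ 2` on average, and this is
at most `Φ * (exp (2 * s) - 1) / (exp s - 1)` as long as `Φ ≤ exp s - 1`. -/
lemma tailProb_le_div (m : ℕ) {s : ℝ} (hs : 0 < s) {g : V → ℝ} (hg : ∀ x, 1 ≤ g x) :
    tailProb (Real.exp (2 ^ m * s)) m g ≤ (𝔼 x, g x - 1) / (Real.exp s - 1) := by
  induction m generalizing s g with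
  | zero =>
    have hs1 : 0 < Real.exp s - 1 := by linarith [Real.add_one_lt_exp hs.ne']
    unfold tailProb
    rw [le_div_iff₀ hs1]
    split_ifs with h
    · simp only [pow_zero, one_mul] at h; linarith
    · linarith [one_le_expect hg]
  | succ m ih =>
    have hs1 : 0 < Real.exp s - 1 := by linarith [Real.add_one_lt_exp hs.ne']
    have hexp : Real.exp (2 * s) = Real.exp s ^ 2 := by rw [← Real.exp_nat_mul]; norm_num
    have hΦ := one_le_expect hg
    by_cases hlarge : Real.exp s - 1 ≤ 𝔼 x, g x - 1
    · exact (tailProb_le_one _ _ _).trans ((one_le_div hs1).2 hlarge)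
    have h1 : tailProb (Real.exp (2 ^ (m + 1) * s)) (m + 1) g
        ≤ 𝔼 v, (𝔼 x, shiftMul g v x - 1) / (Real.exp (2 * s) - 1) := by
      refine Finset.expect_le_expect fun v _ => ?_
      rw [pow_succ, mul_assoc]
      exact ih (by positivity) (one_le_shiftMul hg v)
    rw [← Finset.expect_div, expect_sub_one (fun v => 𝔼 x, shiftMul g v x),
      expect_expect_shiftMul, hexp] at h1
    refine h1.trans ?_
    rw [div_le_div_iff₀ (by nlinarith) hs1]
    nlinarith [mul_nonneg (mul_nonneg (sub_nonneg.2 hΦ) hs1.le) (sub_nonneg.2 (not_le.1 hlarge).le)]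

end Doubling

/-- The inequality that lets `400 / (1 + r)` absorb the loss of one doubling step; here
`q = √2`. -/
lemma supersolution_step {q r : ℝ} (hq : q ^ 2 = 2) (hq0 : 0 < q) (hr : 0 < r) :
    7 / 2 * ((1 + r) / r) * (r ^ 2 + r ^ 3) ^ 2 / (Real.exp (2 * r ^ 2) - 1) + 400 / (1 + q * r)
      ≤ 400 / (1 + r) := by
  have hq1 : 7 / 5 ≤ q := by nlinarith
  have hq2 : q ≤ 3 / 2 := by nlinarith
  have hexp : 2 * r ^ 2 + 2 / 3 * r ^ 8 ≤ Real.exp (2 * r ^ 2) - 1 := by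
    have h := Real.sum_le_exp_of_nonneg (x := 2 * r ^ 2) (by positivity) 5
    simp only [Finset.sum_range_succ, Finset.sum_range_zero, Nat.factorial] at h
    norm_num at h
    have : 0 ≤ (2 * r ^ 2) ^ 2 / 2 + (2 * r ^ 2) ^ 3 / 6 := by positivity
    nlinarith
  have hE : 0 < Real.exp (2 * r ^ 2) - 1 := lt_of_lt_of_le (by positivity) hexp
  have hdiff : 400 / (1 + r) - 400 / (1 + q * r) = 400 * (q - 1) * r / ((1 + r) * (1 + q * r)) := by
    field_simp; ring
  have hlhs : 7 / 2 * ((1 + r) / r) * (r ^ 2 + r ^ 3) ^ 2 = 7 / 2 * r ^ 3 * (1 + r) ^ 3 := by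
    field_simp
  rw [← le_sub_iff_add_le, hdiff, hlhs, div_le_div_iff₀ hE (by positivity)]
  have h5 : (1 + r) ^ 5 ≤ 16 * (1 + r ^ 5) := by
    have := add_pow_le (zero_le_one' ℝ) hr.le 5
    norm_num at this; linarith
  have h6 : r ^ 5 ≤ 1 + r ^ 6 := by
    rcases le_total r 1 with h | h
    · have := pow_le_one₀ hr.le h (n := 5); have : 0 ≤ r ^ 6 := by positivity
      linarith
    · have := pow_le_pow_right₀ h (show 5 ≤ 6 by norm_num); linarith
  calc 7 / 2 * r ^ 3 * (1 + r) ^ 3 * ((1 + r) * (1 + q * r))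
      ≤ 7 / 2 * r ^ 3 * (1 + r) ^ 3 * ((1 + r) * (3 / 2 * (1 + r))) := by
        gcongr; nlinarith
    _ = 21 / 4 * r ^ 3 * (1 + r) ^ 5 := by ring
    _ ≤ 21 / 4 * r ^ 3 * (16 * (1 + (1 + r ^ 6))) := by gcongr; linarith
    _ ≤ 160 * r * (2 * r ^ 2 + 2 / 3 * r ^ 8) := by
        have : 0 ≤ r ^ 3 := by positivity
        have : 0 ≤ r ^ 9 := by positivity
        nlinarith
    _ ≤ 400 * (q - 1) * r * (Real.exp (2 * r ^ 2) - 1) := by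
        exact mul_le_mul (by nlinarith) hexp (by positivity) (by nlinarith)

section Doubling

variable {V : Type*} [AddCommGroup V] [Fintype V]

/-- The second-order bound. On the typical path `𝔼 g - 1` doubles at each step and so remains below
the barrier `a * (r ^ 2 + r ^ 3)`, where `r ^ 2` doubles at each step. Leaving the barrier requires
an excess of order `a * r ^ 3`, whose mean is only of order `(a * r ^ 2) ^ 2`, and afterwards the
first-moment bound supplies another factor; the losses sum to `O(a ^ 2)`. -/
lemma tailProb_le_sq (m : ℕ) {a r : ℝ} (ha : 0 < a) (ha' : a ≤ 1 / 10) (hr : 0 < r)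
    {g : V → ℝ} (hg : ∀ x, 1 ≤ g x) (hgr : 𝔼 x, g x - 1 ≤ a * (r ^ 2 + r ^ 3)) :
    tailProb (Real.exp (2 ^ m * r ^ 2)) m g ≤ a ^ 2 * (400 / (1 + r)) := by
  induction m generalizing r g with
  | zero =>
    unfold tailProb
    rw [if_neg]
    · positivity
    · intro h
      simp only [pow_zero, one_mul] at h
      have h1 := Real.quadratic_le_exp_of_nonneg (x := r ^ 2) (by positivity)
      have h2 : a * (r ^ 2 + r ^ 3) ≤ 1 / 10 * (r ^ 2 + r ^ 3) := by gcongr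
      have h3 : r ^ 3 ≤ r ^ 2 + r ^ 4 := by nlinarith [sq_nonneg (r * (r - 1)), sq_nonneg r]
      have h4 : 0 < r ^ 2 := by positivity
      have h5 : 0 < r ^ 4 := by positivity
      nlinarith
  | succ m ih =>
    obtain ⟨q, hq, hq0⟩ : ∃ q : ℝ, q ^ 2 = 2 ∧ 0 < q := ⟨√2, by norm_num, by positivity⟩
    have hq1 : 7 / 5 ≤ q := by nlinarith
    have hqr : (q * r) ^ 2 = 2 * r ^ 2 := by rw [mul_pow, hq]
    have hqr3 : (q * r) ^ 3 = 2 * q * r ^ 3 := by linear_combination (q * r ^ 3) * hq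
    have hE : 0 < Real.exp (2 * r ^ 2) - 1 := by
      have := Real.one_lt_exp_iff.2 (show 0 < 2 * r ^ 2 by positivity)
      linarith
    have hΦ := one_le_expect hg
    have hpt : ∀ v, tailProb (Real.exp (2 ^ (m + 1) * r ^ 2)) m (shiftMul g v) ≤
        a ^ 2 * (400 / (1 + q * r)) +
          7 / 2 * ((1 + r) / r) / (Real.exp (2 * r ^ 2) - 1) * excess g v := by
      intro v
      have hex := excess_nonneg hg v
      have hgv := one_le_shiftMul hg v
      have hpow : (2 : ℝ) ^ (m + 1) * r ^ 2 = 2 ^ m * (q * r) ^ 2 := by rw [hqr]; ring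
      have heq := expect_shiftMul_eq g v
      rw [hpow]
      by_cases hb : 𝔼 x, shiftMul g v x - 1 ≤ a * ((q * r) ^ 2 + (q * r) ^ 3)
      · have h := ih (r := q * r) (by positivity) hgv hb
        have : 0 ≤ 7 / 2 * ((1 + r) / r) / (Real.exp (2 * r ^ 2) - 1) * excess g v := by positivity
        linarith
      · have h := tailProb_le_div m (s := (q * r) ^ 2) (by positivity) hgv
        have h0 : 0 ≤ a ^ 2 * (400 / (1 + q * r)) := by positivity
        refine h.trans (le_trans ?_ (le_add_of_nonneg_left h0))
        rw [hqr, div_mul_eq_mul_div]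
        refine div_le_div_of_nonneg_right ?_ hE.le
        rw [hqr, hqr3] at hb
        push Not at hb
        -- Leaving the barrier forces an excess of at least `(4 / 5) * a * r ^ 3`.
        have har : 0 < a * r ^ 3 := by positivity
        have hex' : 4 / 5 * (a * r ^ 3) ≤ excess g v := by nlinarith
        have hcmp : 2 * (a * (r ^ 2 + r ^ 3)) ≤ 5 / 2 * ((1 + r) / r) * excess g v := by
          calc 2 * (a * (r ^ 2 + r ^ 3)) = 5 / 2 * ((1 + r) / r) * (4 / 5 * (a * r ^ 3)) := by
                field_simp; ring
            _ ≤ _ := by gcongr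
        have h1r : 1 ≤ (1 + r) / r := by rw [le_div_iff₀ hr]; linarith
        nlinarith [mul_le_mul_of_nonneg_right h1r hex]
    have havg : tailProb (Real.exp (2 ^ (m + 1) * r ^ 2)) (m + 1) g ≤
        a ^ 2 * (400 / (1 + q * r)) +
          7 / 2 * ((1 + r) / r) / (Real.exp (2 * r ^ 2) - 1) * (𝔼 x, g x - 1) ^ 2 := by
      have : Nonempty V := ⟨0⟩
      rw [← expect_excess, Finset.mul_expect]
      refine (Finset.expect_le_expect fun v _ => hpt v).trans_eq ?_
      rw [Finset.expect_add_distrib, Fintype.expect_const]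
    have hsq : (𝔼 x, g x - 1) ^ 2 ≤ (a * (r ^ 2 + r ^ 3)) ^ 2 :=
      pow_le_pow_left₀ (by linarith) hgr 2
    calc _ ≤ _ := havg
      _ ≤ a ^ 2 * (400 / (1 + q * r)) + 7 / 2 * ((1 + r) / r) / (Real.exp (2 * r ^ 2) - 1) *
          (a * (r ^ 2 + r ^ 3)) ^ 2 := by gcongr
      _ = a ^ 2 * (7 / 2 * ((1 + r) / r) * (r ^ 2 + r ^ 3) ^ 2 / (Real.exp (2 * r ^ 2) - 1) +
          400 / (1 + q * r)) := by ring
      _ ≤ _ := by gcongr; exact supersolution_step hq hq0 hr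

/-- If the starting weight has mean `1 + β * 2 ^ (-m)` at most, then `m` doublings bring the mean
to `exp t` with probability `O((β / t) ^ 2)`. -/
lemma tailProb_exp_le (m : ℕ) {β t : ℝ} (hβ : 0 < β) (ht : 0 < t) {g : V → ℝ}
    (hg : ∀ x, 1 ≤ g x) (hgβ : 𝔼 x, g x - 1 ≤ β / 2 ^ m) :
    tailProb (Real.exp t) m g ≤ 400 * (β / t) ^ 2 := by
  by_cases hsmall : β / t ≤ 1 / 10
  · have hr2 : √(t / 2 ^ m) ^ 2 = t / 2 ^ m := Real.sq_sqrt (by positivity)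
    have hr0 : 0 < √(t / 2 ^ m) := Real.sqrt_pos.2 (by positivity)
    have ht2 : t = 2 ^ m * √(t / 2 ^ m) ^ 2 := by rw [hr2]; field_simp
    have hb : β / 2 ^ m ≤ β / t * (√(t / 2 ^ m) ^ 2 + √(t / 2 ^ m) ^ 3) := by
      calc β / 2 ^ m = β / t * √(t / 2 ^ m) ^ 2 := by rw [hr2]; field_simp
        _ ≤ _ := by gcongr; exact le_add_of_nonneg_right (by positivity)
    have h := tailProb_le_sq m (by positivity) hsmall hr0 hg (hgβ.trans hb)
    rw [← ht2] at h
    refine h.trans ?_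
    rw [mul_comm]
    gcongr
    exact div_le_self (by norm_num) (by linarith)
  · refine (tailProb_le_one _ _ _).trans ?_
    push Not at hsmall
    nlinarith

/-- After all doubling steps the weight of `x` is the product of the initial weights over the
combinations `x + ∑ ε i • v i`. -/
lemma tailProb_eq_expect [Module (ZMod 2) V] (B : ℝ) (m : ℕ) (g : V → ℝ) :
    tailProb B m g = 𝔼 v : Fin m → V,
      if B ≤ 𝔼 x, ∏ ε : Fin m → ZMod 2, g (x + ∑ i, ε i • v i) then (1 : ℝ) else 0 := by
  induction m generalizing g with
  | zero => simp [tailProb]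
  | succ m ih =>
    have hstep : tailProb B (m + 1) g = 𝔼 v, tailProb B m (shiftMul g v) := rfl
    simp_rw [hstep, ih]
    rw [← Finset.expect_product' Finset.univ Finset.univ (fun (v : V) (w : Fin m → V) =>
      if B ≤ 𝔼 x, ∏ ε : Fin m → ZMod 2, shiftMul g v (x + ∑ i, ε i • w i) then (1 : ℝ) else 0)]
    rw [Finset.univ_product_univ]
    refine Fintype.expect_equiv (Fin.consEquiv fun _ => V) _ _ fun p => ?_
    have hprod : ∀ x, ∏ ε : Fin (m + 1) → ZMod 2,
        g (x + ∑ i, ε i • (Fin.consEquiv fun _ => V) p i) =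
        ∏ ε : Fin m → ZMod 2, shiftMul g p.1 (x + ∑ i, ε i • p.2 i) := by
      intro x
      rw [← Fintype.prod_equiv (Fin.consEquiv fun _ => ZMod 2)
        (fun ε => g (x + (ε.1 • p.1 + ∑ i, ε.2 i • p.2 i))) _
        (fun ε => by simp [Fin.consEquiv, Fin.sum_univ_succ]),
        Fintype.prod_prod_type_right]
      refine Finset.prod_congr rfl fun ε _ => ?_
      have : (Finset.univ : Finset (ZMod 2)) = {0, 1} := by decide
      rw [this, Finset.prod_pair (by decide)]
      simp only [shiftMul, zero_smul, one_smul, zero_add]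
      congr 2
      abel
    simp_rw [hprod]

end Doubling

/-! ### Random maps and random kernels -/

/-- Random `m` vectors of `𝔽₂ ^ m` are independent with probability at least `1 / 4`. -/
lemma two_pow_le_four_mul_prod (m : ℕ) :
    (2 : ℝ) ^ (m * m) ≤ 4 * (∏ i : Fin m, (2 ^ m - 2 ^ (i : ℕ)) : ℕ) := by
  have key : (2 : ℝ) ^ (m * m) * (2 ^ m + 2) ≤
      4 * 2 ^ m * ∏ i : Fin m, ((2 : ℝ) ^ m - 2 ^ (i : ℕ)) := by
    induction m with
    | zero => norm_num
    | succ m ih =>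
      have hrec : ∏ i : Fin (m + 1), ((2 : ℝ) ^ (m + 1) - 2 ^ (i : ℕ)) =
          (2 * 2 ^ m - 1) * (2 ^ m * ∏ i : Fin m, ((2 : ℝ) ^ m - 2 ^ (i : ℕ))) := by
        have hdouble : ∏ i : Fin m, ((2 : ℝ) ^ (m + 1) - 2 ^ ((i : ℕ) + 1)) =
            2 ^ m * ∏ i : Fin m, ((2 : ℝ) ^ m - 2 ^ (i : ℕ)) := by
          calc _ = ∏ i : Fin m, 2 * ((2 : ℝ) ^ m - 2 ^ (i : ℕ)) :=
                Finset.prod_congr rfl fun i _ => by ring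
            _ = _ := by rw [Finset.prod_mul_distrib, Fin.prod_const]
        rw [Fin.prod_univ_succ]
        simp only [Fin.val_zero, Fin.val_succ, hdouble]
        ring
      rcases Nat.eq_zero_or_pos m with rfl | hm
      · norm_num
      rw [hrec]
      have hX : (2 : ℝ) ≤ 2 ^ m := by
        simpa using pow_le_pow_right₀ (one_le_two (α := ℝ)) hm
      rw [show (2 : ℝ) ^ ((m + 1) * (m + 1)) = 2 ^ (m * m) * (2 * (2 ^ m) ^ 2) by ring,
        pow_succ (2 : ℝ) m]
      generalize (2 : ℝ) ^ m = X at *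
      generalize ∏ i : Fin m, (X - (2 : ℝ) ^ (i : ℕ)) = c at *
      have hY : (0 : ℝ) < 2 ^ (m * m) := by positivity
      generalize (2 : ℝ) ^ (m * m) = Y at *
      calc Y * (2 * X ^ 2) * (X * 2 + 2) ≤ 2 * X * (2 * X - 1) * (Y * (X + 2)) := by
            have : 0 ≤ Y * X * (X - 2) := by
              apply mul_nonneg (by positivity) (by linarith)
            nlinarith
        _ ≤ 2 * X * (2 * X - 1) * (4 * X * c) := by
            apply mul_le_mul_of_nonneg_left ih
            apply mul_nonneg (by linarith) (by linarith)
        _ = _ := by ring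
  have hcast : ((∏ i : Fin m, (2 ^ m - 2 ^ (i : ℕ)) : ℕ) : ℝ) =
      ∏ i : Fin m, ((2 : ℝ) ^ m - 2 ^ (i : ℕ)) := by
    push_cast
    refine Finset.prod_congr rfl fun i _ => ?_
    rw [Nat.cast_sub (Nat.pow_le_pow_right (by norm_num) i.2.le)]
    push_cast; rfl
  rw [hcast]
  have hX : (0 : ℝ) < 2 ^ m := by positivity
  have hY : (0 : ℝ) < 2 ^ (m * m) := by positivity
  nlinarith

open Classical in
/-- Two uniform choices of an `m`-dimensional subspace are compared: the kernel of a uniform map to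
`𝔽₂ ^ l` and the span of `m` uniform vectors, each subject to nondegeneracy. The pairs `(h, v)`
with `v` a basis of `ker h` are counted in two ways. -/
lemma card_surjective_le {V : Type*} [AddCommGroup V] [Module (ZMod 2) V] [Fintype V] {l m : ℕ}
    [Fintype (V →ₗ[ZMod 2] F2Vec l)] (hV : Module.finrank (ZMod 2) V = l + m)
    (P : (V →ₗ[ZMod 2] F2Vec l) → Prop) (Q : (Fin m → V) → Prop)
    (hPQ : ∀ (h : V →ₗ[ZMod 2] F2Vec l) (v : Fin m → V), Function.Surjective h → P h →
      Submodule.span (ZMod 2) (Set.range v) = LinearMap.ker h → Q v) :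
    ((Finset.univ.filter fun h : V →ₗ[ZMod 2] F2Vec l => Function.Surjective h ∧ P h).card : ℝ) /
        Fintype.card (V →ₗ[ZMod 2] F2Vec l) ≤
      4 * (((Finset.univ.filter Q).card : ℝ) / Fintype.card (Fin m → V)) := by
  set A : Finset (V →ₗ[ZMod 2] F2Vec l) :=
    Finset.univ.filter fun h : V →ₗ[ZMod 2] F2Vec l => Function.Surjective h ∧ P h with hA
  set B := Finset.univ.filter Q with hB
  have hVcard : Fintype.card V = 2 ^ (l + m) := by
    rw [Module.card_eq_pow_finrank (K := ZMod 2), ZMod.card, hV]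
  have hcardH : Fintype.card (V →ₗ[ZMod 2] F2Vec l) = 2 ^ ((l + m) * l) := by
    rw [Module.card_eq_pow_finrank (K := ZMod 2), ZMod.card, Module.finrank_linearMap, hV,
      Module.finrank_fin_fun]
  let r : (V →ₗ[ZMod 2] F2Vec l) → (Fin m → V) → Prop :=
    fun h v => LinearIndependent (ZMod 2) v ∧ ∀ i, h (v i) = 0
  set c := ∏ i : Fin m, (2 ^ m - 2 ^ (i : ℕ)) with hc
  have hlow : A.card * c ≤ ∑ h ∈ A, (Finset.bipartiteAbove r B h).card := by
    rw [← smul_eq_mul]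
    refine Finset.card_nsmul_le_sum _ _ _ fun h hh => ?_
    obtain ⟨-, hsurj, hPh⟩ := Finset.mem_filter.1 hh
    have hker : Module.finrank (ZMod 2) (LinearMap.ker h) = m := by
      have h1 := LinearMap.finrank_range_add_finrank_ker h
      rw [LinearMap.range_eq_top.2 hsurj, finrank_top, Module.finrank_fin_fun, hV] at h1
      omega
    have hcount := card_linearIndependent (K := ZMod 2) (V := LinearMap.ker h) (k := m) hker.ge
    rw [hker, ZMod.card] at hcount
    rw [hc, ← hcount, Nat.card_eq_fintype_card, Fintype.card_subtype]
    refine Finset.card_le_card_of_injOn (fun v i => (v i : V)) ?_ ?_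
    · intro v hv
      have hv' : LinearIndependent (ZMod 2) v := by simpa using hv
      have hli : LinearIndependent (ZMod 2) fun i => (v i : V) :=
        hv'.map' (LinearMap.ker h).subtype (Submodule.ker_subtype _)
      have hspan : Submodule.span (ZMod 2) (Set.range fun i => (v i : V)) = LinearMap.ker h := by
        have h1 := hv'.span_eq_top_of_card_eq_finrank' (by rw [hker, Fintype.card_fin])
        have h2 := congrArg (Submodule.map (LinearMap.ker h).subtype) h1
        rw [Submodule.map_span, Submodule.map_subtype_top, ← Set.range_comp] at h2
        exact h2
      have hz : ∀ i, h (v i : V) = 0 := fun i => (v i).2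
      simp only [Finset.bipartiteAbove, Finset.coe_filter, Set.mem_ofPred_eq, hB,
        Finset.mem_filter, Finset.mem_univ, true_and]
      exact ⟨hPQ h _ hsurj hPh hspan, hli, hz⟩
    · intro v _ w _ hvw
      funext i
      exact Subtype.ext (congrFun hvw i)
  have hupp : ∑ v ∈ B, (Finset.bipartiteBelow r A v).card ≤ B.card * 2 ^ (l * l) := by
    rw [← smul_eq_mul]
    refine Finset.sum_le_card_nsmul _ _ _ fun v _ => ?_
    by_cases hli : LinearIndependent (ZMod 2) v
    · set U := Submodule.span (ZMod 2) (Set.range v)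
      have hU : Module.finrank (ZMod 2) U = m := by
        rw [finrank_span_eq_card hli, Fintype.card_fin]
      have hQ : Module.finrank (ZMod 2) (V ⧸ U) = l := by
        have := U.finrank_quotient_add_finrank
        omega
      have : Finite (V ⧸ U →ₗ[ZMod 2] F2Vec l) := Module.finite_of_finite (ZMod 2)
      have hcard : Nat.card (V ⧸ U →ₗ[ZMod 2] F2Vec l) = 2 ^ (l * l) := by
        rw [Module.natCard_eq_pow_finrank (K := ZMod 2), Nat.card_zmod, Module.finrank_linearMap,
          hQ, Module.finrank_fin_fun]
      have hle : ∀ h ∈ Finset.bipartiteBelow r A v, U ≤ LinearMap.ker h := by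
        intro h hh
        rw [Submodule.span_le]
        rintro _ ⟨i, rfl⟩
        exact (Finset.mem_filter.1 hh).2.2 i
      rw [← hcard, ← Nat.card_eq_finsetCard]
      refine Nat.card_le_card_of_injective (fun h => U.liftQ h.1 (hle h.1 h.2)) fun h h' hhh => ?_
      ext1
      ext1 x
      exact LinearMap.congr_fun hhh (U.mkQ x)
    · rw [Finset.card_eq_zero.2]
      · exact Nat.zero_le _
      · ext h
        simp [Finset.bipartiteBelow, r, hli]
  have hcount : A.card * c ≤ B.card * 2 ^ (l * l) :=
    hlow.trans ((Finset.sum_card_bipartiteAbove_eq_sum_card_bipartiteBelow r).trans_le hupp)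
  have hcount' : (A.card : ℝ) * c ≤ B.card * 2 ^ (l * l) := by exact_mod_cast hcount
  have hc4 := two_pow_le_four_mul_prod m
  rw [← hc] at hc4
  have hmain : (A.card : ℝ) * 2 ^ (m * m) ≤ 4 * (B.card * 2 ^ (l * l)) := by
    nlinarith [mul_le_mul_of_nonneg_left hc4 (Nat.cast_nonneg (α := ℝ) A.card)]
  rw [hcardH, Fintype.card_fun, Fintype.card_fin, hVcard, ← mul_div_assoc, div_le_div_iff₀
    (by positivity) (by positivity)]
  push_cast
  calc (A.card : ℝ) * (2 ^ (l + m)) ^ m = A.card * 2 ^ (m * m) * 2 ^ (l * m) := by ring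
    _ ≤ 4 * (B.card * 2 ^ (l * l)) * 2 ^ (l * m) := by gcongr
    _ = _ := by ring

open Classical in
/-- A uniform linear map `V → 𝔽₂ ^ l` fails to be surjective with probability at most
`2 ^ l / |V|`: its range then lies in one of at most `2 ^ l` hyperplanes. -/
lemma card_not_surjective_le {V : Type*} [AddCommGroup V] [Module (ZMod 2) V] [Fintype V] {l : ℕ}
    [Fintype (V →ₗ[ZMod 2] F2Vec l)] :
    ((Finset.univ.filter fun h : V →ₗ[ZMod 2] F2Vec l => ¬ Function.Surjective h).card : ℝ) /
        Fintype.card (V →ₗ[ZMod 2] F2Vec l) ≤ 2 ^ l / Fintype.card V := by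
  have : Finite (Module.Dual (ZMod 2) (F2Vec l)) := Module.finite_of_finite (ZMod 2)
  have := Fintype.ofFinite (Module.Dual (ZMod 2) (F2Vec l))
  set N := Module.finrank (ZMod 2) V with hN
  have hVcard : Fintype.card V = 2 ^ N := by
    rw [Module.card_eq_pow_finrank (K := ZMod 2), ZMod.card]
  have hcardH : Fintype.card (V →ₗ[ZMod 2] F2Vec l) = 2 ^ (N * l) := by
    rw [Module.card_eq_pow_finrank (K := ZMod 2), ZMod.card, Module.finrank_linearMap,
      Module.finrank_fin_fun]
  have hdual : Fintype.card (Module.Dual (ZMod 2) (F2Vec l)) = 2 ^ l := by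
    rw [Module.card_eq_pow_finrank (K := ZMod 2), ZMod.card, Subspace.dual_finrank_eq,
      Module.finrank_fin_fun]
  have hcover : (Finset.univ.filter fun h : V →ₗ[ZMod 2] F2Vec l => ¬ Function.Surjective h) ⊆
      (Finset.univ.filter fun f : Module.Dual (ZMod 2) (F2Vec l) => f ≠ 0).biUnion
        fun f => Finset.univ.filter fun h => ∀ x, f (h x) = 0 := by
    intro h hh
    have hns : ¬ Function.Surjective h := (Finset.mem_filter.1 hh).2
    obtain ⟨f, hf, hle⟩ := Submodule.exists_le_ker_of_lt_top (LinearMap.range h)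
      (lt_top_iff_ne_top.2 fun h' => hns (LinearMap.range_eq_top.1 h'))
    simp only [Finset.mem_biUnion, Finset.mem_filter, Finset.mem_univ, true_and]
    exact ⟨f, hf, fun x => hle ⟨x, rfl⟩⟩
  have hone : ∀ f : Module.Dual (ZMod 2) (F2Vec l), f ≠ 0 →
      (Finset.univ.filter fun h : V →ₗ[ZMod 2] F2Vec l => ∀ x, f (h x) = 0).card * 2 ^ N ≤
        2 ^ (N * l) := by
    intro f hf
    have hk := Module.Dual.finrank_ker_add_one_of_ne_zero hf
    rw [Module.finrank_fin_fun] at hk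
    have : Finite (V →ₗ[ZMod 2] LinearMap.ker f) := Module.finite_of_finite (ZMod 2)
    have hcard : Nat.card (V →ₗ[ZMod 2] LinearMap.ker f) =
        2 ^ (N * Module.finrank (ZMod 2) (LinearMap.ker f)) := by
      rw [Module.natCard_eq_pow_finrank (K := ZMod 2), Nat.card_zmod, Module.finrank_linearMap]
    have hle : (Finset.univ.filter fun h : V →ₗ[ZMod 2] F2Vec l => ∀ x, f (h x) = 0).card ≤
        Nat.card (V →ₗ[ZMod 2] LinearMap.ker f) := by
      rw [← Fintype.card_subtype, ← Nat.card_eq_fintype_card]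
      refine Nat.card_le_card_of_injective
        (fun h => LinearMap.codRestrict (LinearMap.ker f) h.1 h.2) fun h h' hhh => ?_
      ext1
      ext1 x
      exact congrArg Subtype.val (LinearMap.congr_fun hhh x)
    calc _ ≤ 2 ^ (N * Module.finrank (ZMod 2) (LinearMap.ker f)) * 2 ^ N :=
          Nat.mul_le_mul_right _ (hle.trans_eq hcard)
      _ = 2 ^ (N * l) := by
          rw [← pow_add, ← Nat.mul_succ]
          exact congrArg (fun k => 2 ^ (N * k)) hk
  have hsum : (Finset.univ.filter fun h : V →ₗ[ZMod 2] F2Vec l => ¬ Function.Surjective h).card *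
      2 ^ N ≤ 2 ^ l * 2 ^ (N * l) := by
    calc _ ≤ (∑ f ∈ Finset.univ.filter fun f : Module.Dual (ZMod 2) (F2Vec l) => f ≠ 0,
          (Finset.univ.filter fun h : V →ₗ[ZMod 2] F2Vec l => ∀ x, f (h x) = 0).card) * 2 ^ N :=
          Nat.mul_le_mul_right _ ((Finset.card_le_card hcover).trans Finset.card_biUnion_le)
      _ ≤ (Finset.univ.filter fun f : Module.Dual (ZMod 2) (F2Vec l) => f ≠ 0).card *
          2 ^ (N * l) := by
          rw [Finset.sum_mul, ← smul_eq_mul]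
          exact Finset.sum_le_card_nsmul _ _ _ fun f hf => hone f (Finset.mem_filter.1 hf).2
      _ ≤ _ := by
          gcongr
          rw [← hdual]
          exact Finset.card_le_univ _
  rw [hcardH, hVcard, div_le_div_iff₀ (by positivity) (by positivity)]
  exact_mod_cast hsum

/-! ### Heavy fibres and the maximum load -/

section Load

/-- The weight that is `β` on `S` and `1` elsewhere. -/
def setWeight {V : Type*} [DecidableEq V] (S : Finset V) (β : ℝ) (x : V) : ℝ :=
  if x ∈ S then β else 1

lemma one_le_setWeight {V : Type*} [DecidableEq V] (S : Finset V) {β : ℝ} (hβ : 1 ≤ β) (x : V) :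
    1 ≤ setWeight S β x := by
  unfold setWeight; split_ifs <;> linarith

lemma expect_setWeight {V : Type*} [DecidableEq V] [Fintype V] [Nonempty V] (S : Finset V)
    (β : ℝ) : 𝔼 x, setWeight S β x - 1 = (β - 1) * (S.card / Fintype.card V) := by
  have h : ∀ x, setWeight S β x = 1 + if x ∈ S then β - 1 else 0 := fun x => by
    unfold setWeight; split_ifs <;> ring
  simp_rw [h]
  rw [Finset.expect_add_distrib, Fintype.expect_const, Fintype.expect_eq_sum_div_card,
    Finset.sum_ite_mem, Finset.univ_inter, Finset.sum_const, nsmul_eq_mul]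
  ring

variable {V : Type*} [AddCommGroup V] [Module (ZMod 2) V] [DecidableEq V]

/-- If `v` spans the kernel of `h`, the doubled weight of `x` is at least `β` to the number of
points of `S` in the fibre of `h` through `x`. -/
lemma pow_card_fiber_le_prod {W : Type*} [AddCommGroup W] [Module (ZMod 2) W] [DecidableEq W]
    (S : Finset V) {β : ℝ} (hβ : 1 ≤ β) {m : ℕ} {v : Fin m → V} {h : V →ₗ[ZMod 2] W}
    (hv : Submodule.span (ZMod 2) (Set.range v) = LinearMap.ker h) (x : V) :
    β ^ (S.filter fun x' => h x' = h x).card ≤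
      ∏ ε : Fin m → ZMod 2, setWeight S β (x + ∑ i, ε i • v i) := by
  unfold setWeight
  rw [Finset.prod_ite, Finset.prod_const, Finset.prod_const_one, mul_one]
  refine pow_le_pow_right₀ hβ (Finset.card_le_card_of_surjOn (fun ε => x + ∑ i, ε i • v i) ?_)
  intro x' hx'
  simp only [Finset.coe_filter, Set.mem_ofPred_eq] at hx'
  have hmem : x' - x ∈ Submodule.span (ZMod 2) (Set.range v) := by
    rw [hv, LinearMap.mem_ker, map_sub, hx'.2, sub_self]
  obtain ⟨ε, hε⟩ := (Submodule.mem_span_range_iff_exists_fun _).1 hmem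
  have hx : x + ∑ i, ε i • v i = x' := by rw [hε]; abel
  exact ⟨ε, by simp [hx, hx'.1], hx⟩

variable [Fintype V]

open Classical in
/-- The probability that a uniform linear map `V → 𝔽₂ ^ l` puts at least `T` of `2 ^ l` given
points into one bin, for arbitrary `V` of dimension `l + m`. The weight base `e * 2 ^ (l / T)` is
chosen so that one bin of load `T` forces a final mean weight of at least `exp T`. -/
lemma card_heavy_le {l m : ℕ} [Fintype (V →ₗ[ZMod 2] F2Vec l)]
    (hV : Module.finrank (ZMod 2) V = l + m) (S : Finset V) (hS : S.card = 2 ^ l) {T : ℝ}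
    (hT : 0 < T) :
    ((Finset.univ.filter fun h : V →ₗ[ZMod 2] F2Vec l =>
        ∃ y, T ≤ ((S.filter fun x => h x = y).card : ℝ)).card : ℝ) /
        Fintype.card (V →ₗ[ZMod 2] F2Vec l) ≤
      1600 * (Real.exp 1 * 2 ^ ((l : ℝ) / T) / T) ^ 2 + (1 / 2) ^ m := by
  have hVcard : Fintype.card V = 2 ^ (l + m) := by
    rw [Module.card_eq_pow_finrank (K := ZMod 2), ZMod.card, hV]
  set β : ℝ := Real.exp 1 * 2 ^ ((l : ℝ) / T) with hβdef
  have hβ1 : 1 ≤ β := one_le_mul_of_one_le_of_one_le (Real.one_le_exp zero_le_one)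
    (Real.one_le_rpow one_le_two (by positivity))
  have hβT : β ^ T = Real.exp T * 2 ^ l := by
    rw [hβdef, Real.mul_rpow (by positivity) (by positivity), ← Real.exp_mul, one_mul,
      ← Real.rpow_mul (by norm_num), div_mul_cancel₀ _ hT.ne', Real.rpow_natCast]
  let P : (V →ₗ[ZMod 2] F2Vec l) → Prop := fun h =>
    ∃ y, T ≤ ((S.filter fun x => h x = y).card : ℝ)
  let Q : (Fin m → V) → Prop := fun v =>
    Real.exp T ≤ 𝔼 x, ∏ ε : Fin m → ZMod 2, setWeight S β (x + ∑ i, ε i • v i)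
  have hPQ : ∀ (h : V →ₗ[ZMod 2] F2Vec l) (v : Fin m → V), Function.Surjective h → P h →
      Submodule.span (ZMod 2) (Set.range v) = LinearMap.ker h → Q v := by
    rintro h v hsurj ⟨y, hy⟩ hv
    obtain ⟨x₀, hx₀⟩ := hsurj y
    have hfib : 2 ^ m ≤ (Finset.univ.filter fun x => h x = y).card := by
      have hker : Module.finrank (ZMod 2) (LinearMap.ker h) = m := by
        have h1 := LinearMap.finrank_range_add_finrank_ker h
        rw [LinearMap.range_eq_top.2 hsurj, finrank_top, Module.finrank_fin_fun, hV] at h1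
        omega
      have hcard : Nat.card (LinearMap.ker h) = 2 ^ m := by
        rw [Module.natCard_eq_pow_finrank (K := ZMod 2), Nat.card_zmod, hker]
      rw [← hcard, ← Fintype.card_subtype, ← Nat.card_eq_fintype_card]
      refine Nat.card_le_card_of_injective
        (fun k => ⟨x₀ + k, by rw [map_add, hx₀, LinearMap.mem_ker.1 k.2, add_zero]⟩) ?_
      intro k k' hk
      exact Subtype.ext (add_left_cancel (congrArg Subtype.val hk))
    have hnonneg : ∀ x, 0 ≤ ∏ ε : Fin m → ZMod 2, setWeight S β (x + ∑ i, ε i • v i) := fun x =>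
      Finset.prod_nonneg fun ε _ => zero_le_one.trans (one_le_setWeight S hβ1 _)
    have hsum : (2 : ℝ) ^ m * (Real.exp T * 2 ^ l) ≤
        ∑ x, ∏ ε : Fin m → ZMod 2, setWeight S β (x + ∑ i, ε i • v i) := by
      calc (2 : ℝ) ^ m * (Real.exp T * 2 ^ l)
          ≤ (Finset.univ.filter fun x => h x = y).card * (Real.exp T * 2 ^ l) := by
            gcongr; exact_mod_cast hfib
        _ ≤ ∑ x ∈ Finset.univ.filter fun x => h x = y,
            ∏ ε : Fin m → ZMod 2, setWeight S β (x + ∑ i, ε i • v i) := by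
            rw [← nsmul_eq_mul]
            refine Finset.card_nsmul_le_sum _ _ _ fun x hx => ?_
            have hxy : h x = y := (Finset.mem_filter.1 hx).2
            refine le_trans ?_ (pow_card_fiber_le_prod S hβ1 hv x)
            rw [← hβT, hxy, ← Real.rpow_natCast]
            exact Real.rpow_le_rpow_of_exponent_le hβ1 hy
        _ ≤ _ := Finset.sum_le_sum_of_subset_of_nonneg (Finset.filter_subset _ _)
            fun x _ _ => hnonneg x
    change Real.exp T ≤ _
    rw [Fintype.expect_eq_sum_div_card, le_div_iff₀ (by rw [hVcard]; positivity), hVcard]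
    refine le_trans (le_of_eq ?_) hsum
    push_cast; ring
  have hQ : ((Finset.univ.filter Q).card : ℝ) / Fintype.card (Fin m → V) ≤ 400 * (β / T) ^ 2 := by
    have h1 : ((Finset.univ.filter Q).card : ℝ) / Fintype.card (Fin m → V) =
        tailProb (Real.exp T) m (setWeight S β) := by
      rw [tailProb_eq_expect, Fintype.expect_eq_sum_div_card, Finset.sum_boole]
    rw [h1]
    refine tailProb_exp_le m (by positivity) hT (one_le_setWeight S hβ1) ?_
    have : Nonempty V := ⟨0⟩
    rw [expect_setWeight, hS, hVcard]
    push_cast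
    rw [pow_add, div_mul_cancel_left₀ (by positivity), ← div_eq_mul_inv]
    gcongr
    linarith
  have hsplit : (Finset.univ.filter P) ⊆
      (Finset.univ.filter fun h : V →ₗ[ZMod 2] F2Vec l => Function.Surjective h ∧ P h) ∪
      (Finset.univ.filter fun h : V →ₗ[ZMod 2] F2Vec l => ¬ Function.Surjective h) := by
    intro h hh
    have hP : P h := (Finset.mem_filter.1 hh).2
    by_cases hs : Function.Surjective h <;> simp [hs, hP]
  have hcard := (Finset.card_le_card hsplit).trans (Finset.card_union_le _ _)
  -- `convert` reconciles the decidability instances of the filters.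
  have hsurj : ((Finset.univ.filter fun h : V →ₗ[ZMod 2] F2Vec l =>
      Function.Surjective h ∧ P h).card : ℝ) / Fintype.card (V →ₗ[ZMod 2] F2Vec l) ≤
      4 * (((Finset.univ.filter Q).card : ℝ) / Fintype.card (Fin m → V)) := by
    convert card_surjective_le hV P Q hPQ
  have hnot : ((Finset.univ.filter fun h : V →ₗ[ZMod 2] F2Vec l =>
      ¬ Function.Surjective h).card : ℝ) / Fintype.card (V →ₗ[ZMod 2] F2Vec l) ≤
      2 ^ l / (2 ^ (l + m) : ℕ) := by
    rw [← hVcard]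
    convert card_not_surjective_le (V := V) (l := l)
  have hcard' := (Nat.cast_le (α := ℝ)).2 hcard
  rw [Nat.cast_add] at hcard'
  have hdiv := div_le_div_of_nonneg_right hcard'
    (Nat.cast_nonneg (α := ℝ) (Fintype.card (V →ₗ[ZMod 2] F2Vec l)))
  rw [add_div] at hdiv
  have hhalf : (2 : ℝ) ^ l / (2 ^ (l + m) : ℕ) = (1 / 2) ^ m := by
    push_cast
    rw [pow_add, div_mul_cancel_left₀ (by positivity), one_div, inv_pow]
  rw [hhalf] at hnot
  have hfinal : ((Finset.univ.filter P).card : ℝ) / Fintype.card (V →ₗ[ZMod 2] F2Vec l) ≤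
      1600 * (β / T) ^ 2 + (1 / 2) ^ m := by linarith
  convert hfinal

end Load

/-- The maximum load of `2 ^ l` keys reaches `T` with probability `O((2 ^ (l / T) / T) ^ 2)`.

A uniform map on `𝔽₂ ^ u` is the restriction of a uniform map on `𝔽₂ ^ u × 𝔽₂ ^ w`, for every `w`;
letting `w` grow removes the contribution of non-surjective maps. -/
lemma prLinHash_maxLoad_le {u l : ℕ} (hlu : l ≤ u) (S : Finset (F2Vec u)) (hS : S.card = 2 ^ l)
    {T : ℝ} (hT : 0 < T) :
    prLinHash u l {h | T ≤ (maxLoad S h : ℝ)} ≤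
      1600 * (Real.exp 1 * 2 ^ ((l : ℝ) / T) / T) ^ 2 := by
  classical
  have hbound : ∀ w : ℕ, prLinHash u l {h | T ≤ (maxLoad S h : ℝ)} ≤
      1600 * (Real.exp 1 * 2 ^ ((l : ℝ) / T) / T) ^ 2 + (1 / 2) ^ w := by
    intro w
    let V := F2Vec u × F2Vec w
    have hV : Module.finrank (ZMod 2) V = l + (u - l + w) := by
      rw [Module.finrank_prod, Module.finrank_fin_fun, Module.finrank_fin_fun]; omega
    have : Finite (V →ₗ[ZMod 2] F2Vec l) := Module.finite_of_finite (ZMod 2)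
    have := Fintype.ofFinite (V →ₗ[ZMod 2] F2Vec l)
    let ι : F2Vec u ↪ V := ⟨fun x => (x, 0), fun x y h => (Prod.mk.inj h).1⟩
    have hmain := card_heavy_le hV (S.map ι) (by rw [Finset.card_map, hS]) hT
    have hpow : ((1 : ℝ) / 2) ^ (u - l + w) ≤ (1 / 2) ^ w :=
      pow_le_pow_of_le_one (by norm_num) (by norm_num) (by omega)
    refine le_trans ?_ (hmain.trans (by linarith))
    let e := (LinearMap.coprodEquiv (R := ZMod 2) (ZMod 2) (M := F2Vec u) (M₂ := F2Vec w)
      (M₃ := F2Vec l)).toEquiv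
    have hcard : Fintype.card (V →ₗ[ZMod 2] F2Vec l) =
        Fintype.card (LinHash u l) * Fintype.card (LinHash w l) := by
      rw [← Fintype.card_prod]; exact (Fintype.card_congr e).symm
    have hinj : (Finset.univ.filter fun h : LinHash u l => T ≤ (maxLoad S h : ℝ)).card *
        Fintype.card (LinHash w l) ≤ (Finset.univ.filter fun h : V →ₗ[ZMod 2] F2Vec l =>
          ∃ y, T ≤ (((S.map ι).filter fun x => h x = y).card : ℝ)).card := by
      rw [← Finset.card_univ, ← Finset.card_product]
      refine Finset.card_le_card_of_injOn e ?_ e.injective.injOn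
      rintro ⟨h, k⟩ hh
      simp only [Finset.coe_product, Set.mem_prod, Finset.mem_coe, Finset.mem_filter,
        Finset.mem_univ, true_and, and_true] at hh
      obtain ⟨y, -, hy⟩ := Finset.exists_mem_eq_sup' Finset.univ_nonempty
        (fun y : F2Vec l => binLoad S h y)
      simp only [Finset.coe_filter, Set.mem_ofPred_eq, Finset.mem_univ, true_and]
      refine ⟨y, hh.trans (le_of_eq ?_)⟩
      rw [maxLoad, hy, binLoad, Finset.filter_map, Finset.card_map]
      congr 3
      ext x
      change h x = y ↔ h x + k 0 = y
      rw [map_zero, add_zero]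
    have hpr : prLinHash u l {h | T ≤ (maxLoad S h : ℝ)} =
        ((Finset.univ.filter fun h : LinHash u l => T ≤ (maxLoad S h : ℝ)).card : ℝ) /
          Fintype.card (LinHash u l) := by
      rw [prLinHash, randomLinHash, PMF.toOuterMeasure_uniformOfFintype_apply,
        ENNReal.toReal_div, ENNReal.toReal_natCast, ENNReal.toReal_natCast]
      congr 2
      exact Fintype.card_subtype _
    have hpos : (0 : ℝ) < Fintype.card (LinHash u l) := by exact_mod_cast Fintype.card_pos
    have hpos' : (0 : ℝ) < Fintype.card (LinHash w l) := by exact_mod_cast Fintype.card_pos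
    rw [hpr, hcard, ← mul_div_mul_right _ _ hpos'.ne', Nat.cast_mul]
    exact div_le_div_of_nonneg_right (by exact_mod_cast hinj) (by positivity)
  have hlim : Filter.Tendsto
      (fun w : ℕ => 1600 * (Real.exp 1 * 2 ^ ((l : ℝ) / T) / T) ^ 2 + ((1 : ℝ) / 2) ^ w)
      Filter.atTop (nhds (1600 * (Real.exp 1 * 2 ^ ((l : ℝ) / T) / T) ^ 2 + 0)) :=
    (tendsto_pow_atTop_nhds_zero_of_lt_one (by norm_num) (by norm_num)).const_add _
  rw [add_zero] at hlim
  exact ge_of_tendsto' hlim hbound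

/-- The choice `T = R * l / log l` turns `2 ^ (l / T)` into `l ^ (1 / R)`. -/
lemma prLinHash_maxLoad_le_of_ratio {u l : ℕ} (hl : 2 ≤ l) (hlu : l ≤ u) (S : Finset (F2Vec u))
    (hS : S.card = 2 ^ l) {R : ℝ} (hR : 1 < R) :
    prLinHash u l {h | R * ((l : ℝ) / Real.logb 2 l) ≤ (maxLoad S h : ℝ)} ≤
      14400 * (Real.logb 2 l ^ 2 / (R ^ 2 * (l : ℝ) ^ (2 - 2 / R))) := by
  have hl2 : (2 : ℝ) ≤ l := by exact_mod_cast hl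
  have hl0 : (0 : ℝ) < l := by linarith
  have hR0 : 0 < R := by linarith
  have hlog : 0 < Real.logb 2 l := Real.logb_pos one_lt_two (by linarith)
  have hT : 0 < R * ((l : ℝ) / Real.logb 2 l) := by positivity
  refine (prLinHash_maxLoad_le hlu S hS hT).trans ?_
  have hexponent : (l : ℝ) / (R * (l / Real.logb 2 l)) = Real.logb 2 l * (1 / R) := by
    field_simp
  have hpow : (2 : ℝ) ^ ((l : ℝ) / (R * (l / Real.logb 2 l))) = (l : ℝ) ^ (1 / R) := by
    rw [hexponent, Real.rpow_mul (by norm_num), Real.rpow_logb two_pos (by norm_num) hl0]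
  have hsq : ((l : ℝ) ^ (1 / R)) ^ 2 * (l : ℝ) ^ (2 - 2 / R) = l ^ 2 := by
    rw [← Real.rpow_natCast, ← Real.rpow_mul hl0.le, ← Real.rpow_add hl0, ← Real.rpow_natCast]
    congr 1
    push_cast
    ring
  have hsq' : ((l : ℝ) ^ (1 / R)) ^ 2 = l ^ 2 / (l : ℝ) ^ (2 - 2 / R) := by
    rw [← hsq, mul_div_cancel_right₀ _ (Real.rpow_pos_of_pos hl0 _).ne']
  have he : Real.exp 1 ^ 2 ≤ 9 := by
    have := Real.exp_one_lt_d9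
    have := Real.exp_pos 1
    nlinarith
  rw [hpow]
  have hp : 0 < (l : ℝ) ^ (2 - 2 / R) := Real.rpow_pos_of_pos hl0 _
  calc 1600 * (Real.exp 1 * (l : ℝ) ^ (1 / R) / (R * (l / Real.logb 2 l))) ^ 2
      = 1600 * Real.exp 1 ^ 2 * (((l : ℝ) ^ (1 / R)) ^ 2 * Real.logb 2 l ^ 2 / (R ^ 2 * l ^ 2)) := by
        field_simp
    _ = 1600 * Real.exp 1 ^ 2 * (Real.logb 2 l ^ 2 / (R ^ 2 * (l : ℝ) ^ (2 - 2 / R))) := by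
        rw [hsq']; field_simp
    _ ≤ 1600 * 9 * (Real.logb 2 l ^ 2 / (R ^ 2 * (l : ℝ) ^ (2 - 2 / R))) := by gcongr
    _ = _ := by norm_num

theorem theorem3p7 :
    ∃ (C D : ℝ) (l₀ : ℕ), 0 < C ∧ 0 < D ∧
      ∀ (u l n : ℕ), l₀ ≤ l → l ≤ u → n = 2 ^ l →
        ∀ S : Finset (F2Vec u), S.card = n →
          ∀ R : ℝ, 1 < R →
            (D * Real.log l ≤ R * (l : ℝ) ^ (1 - 1 / R) →
              prLinHash u l {h | R * ((l : ℝ) / Real.logb 2 l) ≤ (maxLoad S h : ℝ)} ≤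
                C * ((Real.log l) ^ 2 / (R ^ 2 * (l : ℝ) ^ (2 - 2 / R)))) ∧
            (D * Real.logb 2 (Real.logb 2 n) ≤ R * (Real.logb 2 n) ^ (1 - 1 / R) →
              prLinHash u l
                  {h | R * (Real.logb 2 n / Real.logb 2 (Real.logb 2 n)) ≤ (maxLoad S h : ℝ)} ≤
                C * ((Real.logb 2 (Real.logb 2 n)) ^ 2 /
                  (R ^ 2 * (Real.logb 2 n) ^ (2 - 2 / R)))) := by
  refine ⟨57600, 1, 2, by norm_num, by norm_num, ?_⟩
  rintro u l n hl hlu rfl S hS R hR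
  have hmain := prLinHash_maxLoad_le_of_ratio hl hlu S hS hR
  have hl0 : (0 : ℝ) < l := by
    have : (2 : ℝ) ≤ l := by exact_mod_cast hl
    linarith
  have hp : 0 < (l : ℝ) ^ (2 - 2 / R) := Real.rpow_pos_of_pos hl0 _
  have hR2 : 0 < R ^ 2 := by positivity
  have hlogn : Real.logb 2 ((2 ^ l : ℕ) : ℝ) = l := by
    rw [Nat.cast_pow, Nat.cast_ofNat, Real.logb_pow, Real.logb_self_eq_one one_lt_two, mul_one]
  refine ⟨fun _ => hmain.trans ?_, fun _ => ?_⟩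
  · -- The constant `4` pays for the change of logarithm base, as `1 / 2 < ln 2`.
    have hln2 : 1 / 2 < Real.log 2 := by linarith [Real.log_two_gt_d9]
    have hsq : Real.logb 2 l ^ 2 ≤ 4 * Real.log l ^ 2 := by
      rw [Real.logb, div_pow, div_le_iff₀ (by positivity)]
      have h4 : 1 / 4 ≤ Real.log 2 ^ 2 := by nlinarith
      nlinarith [mul_le_mul_of_nonneg_left h4 (sq_nonneg (Real.log l))]
    calc 14400 * (Real.logb 2 l ^ 2 / (R ^ 2 * (l : ℝ) ^ (2 - 2 / R)))
        ≤ 14400 * (4 * Real.log l ^ 2 / (R ^ 2 * (l : ℝ) ^ (2 - 2 / R))) := by gcongr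
      _ = _ := by ring
  · rw [hlogn]
    refine hmain.trans (mul_le_mul_of_nonneg_right (by norm_num) (by positivity))
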